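/- For real $a$ put $$M(a)=\frac{4}{\pi}\int_0^{\pi/2}\frac{x^2\,dx}{x^2+\ln^2\!\left(2e^{-a}\cos x\right)} .$$ Let $\gamma$ be Euler's constant, let $\psi(x)=\frac{d}{dx}\ln\Gamma(x)$ ($x>0$) be the digamma function, and let $\Gamma(s,x)=\int_x^\infty t^{s-1}e^{-t}\,dt$ ($s\in\mathbb{R}$, $x>0$) be the upper incomplete gamma function, so that $\Gamma(0,a)=\int_a^\infty \frac{e^{-t}}{t}\,dt$ for $a>0$. If $0<a<\ln 2$, then the integrals defining $M(a)$ and $\Gamma(0,a)$ and the integral $\int_0^1 e^{-at}\psi(t+1)\,dt$ converge absolutely, and $$M(a)=\frac{\gamma}{a}+\frac{a+\ln(1-e^{-a})+\Gamma(0,a)}{1-e^{-a}}+\frac{1}{1-e^{-a}}\int_0^1 e^{-at}\,\psi(t+1)\,dt .$$ -/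

import Mathlib

open Real MeasureTheory Set

noncomputable section

namespace GlasserMannaOloa

/-- The integrand `x ^ 2 / (x ^ 2 + ln ^ 2 (2 e ^ {-a} cos x))`. -/
def integrand (a x : ℝ) : ℝ :=
  x ^ 2 / (x ^ 2 + Real.log (2 * Real.exp (-a) * Real.cos x) ^ 2)

/-- The Glasser-Manna-Oloa integral `M(a)`. -/
def M (a : ℝ) : ℝ :=
  4 / Real.pi * ∫ x in (0 : ℝ)..(Real.pi / 2), integrand a x

/-- The real digamma function `ψ(x) = d/dx ln Γ(x)` (used for `x > 0` only). -/
def digamma (x : ℝ) : ℝ :=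
  deriv (fun y : ℝ => Real.log (Real.Gamma y)) x

/-- On the positive half-line, `digamma` is the restriction of Mathlib's complex digamma
function. -/
theorem ofReal_digamma {x : ℝ} (hx : 0 < x) :
    ((digamma x : ℝ) : ℂ) = Complex.digamma (x : ℂ) := by
  have hne : ∀ m : ℕ, (x : ℂ) ≠ -(m : ℂ) := by
    intro m h
    have h2 : x = -(m : ℝ) := by exact_mod_cast h
    have : (0 : ℝ) ≤ m := Nat.cast_nonneg m
    linarith
  have hneR : ∀ m : ℕ, x ≠ -(m : ℝ) := by
    intro m h
    have : (0 : ℝ) ≤ m := Nat.cast_nonneg m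
    linarith
  have hG := Real.differentiableAt_Gamma hneR
  have hc := (Complex.differentiableAt_Gamma (x : ℂ) hne).hasDerivAt.comp_ofReal
  have hr := hG.hasDerivAt.ofReal_comp
  have hcongr : (fun y : ℝ => Complex.Gamma (y : ℂ)) = fun y : ℝ => ((Real.Gamma y : ℝ) : ℂ) := by
    funext y
    exact Complex.Gamma_ofReal y
  rw [hcongr] at hc
  have hd := hc.unique hr
  have h1 : digamma x = deriv Real.Gamma x / Real.Gamma x :=
    (hG.hasDerivAt.log (Real.Gamma_pos_of_pos hx).ne').deriv
  rw [h1, Complex.digamma_def, logDeriv_apply, hd, Complex.Gamma_ofReal]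
  push_cast
  rfl

/-- The upper incomplete gamma function `Γ(s, x) = ∫_x^∞ t ^ (s - 1) e ^ {-t} dt` (for real `s`
and `x > 0`). -/
def upperGamma (s x : ℝ) : ℝ :=
  ∫ t in Set.Ioi x, t ^ (s - 1) * Real.exp (-t)

end GlasserMannaOloa

end

/-! With `x = θ/2`, `1 + e^{iθ} = 2 cos x · e^{ix}`, so `log(1 + e^{iθ}) - a` has imaginary part
`x`. Hence `M(a)` is, up to a factor, the imaginary part of `∫ θ f(e^{iθ}) dθ` over `(-π, π)` with
`f(z) = 1 / (log(1+z) - a)`. For `f` holomorphic on the disc, integration by parts and the mean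
value property would turn such a first moment into an integral along the negative radius
(`integral_mul_circleMap`, and `integral_mul_circleMap_one` on the unit circle).

Since `0 < a < ln 2`, `f` has one pole in the disc, at `b = e^a - 1`, with residue `e^a`. The
regular part `g` is bounded and follows the radial formula; the pole is integrated separately. After
`r = 1 - e^{-u}` this leaves an elementary term plus `∫ cutKernel` (`M_eq`).

The remaining integral comes from Gauss's formula for `ψ(t+1) + γ`: multiply by `e^{-at}`, integrate
over `0 ≤ t ≤ 1` and exchange the integrals. The inner integral is a multiple of `cutKernel` minus
`e^{-(a+u)}/(a+u)`, whose integral over `u > 0` is `Γ(0,a)` (`integral_cutKernel`). -/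

namespace GlasserMannaOloa

open Filter Topology

/-! ### First moments on circles -/

/-- On a disc, the first moment of a holomorphic function over a centred circle reduces to an
integral along the negative radius. -/
theorem integral_mul_circleMap {g : ℂ → ℂ} {R ρ : ℝ}
    (hg : DifferentiableOn ℂ g (Metric.ball 0 R)) (h0 : 0 < ρ) (hR : ρ < R) :
    ∫ θ in -π..π, (θ : ℂ) * g (circleMap 0 ρ θ)
      = 2 * π * Complex.I * ∫ r in (0 : ℝ)..ρ, dslope g 0 (-(r : ℂ)) := by
  have hk : DifferentiableOn ℂ (dslope g 0) (Metric.ball 0 R) :=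
    (Complex.differentiableOn_dslope (Metric.ball_mem_nhds _ (h0.trans hR))).2 hg
  obtain ⟨K, hK⟩ := hk.isExactOn_ball
  have hmem : ∀ θ : ℝ, circleMap 0 ρ θ ∈ Metric.ball (0 : ℂ) R := fun θ => by
    simp [abs_of_pos h0, hR]
  have hKd : DifferentiableOn ℂ K (Metric.ball 0 R) := fun z hz =>
    (hK z hz).differentiableAt.differentiableWithinAt
  have hcirc : Continuous (circleMap 0 ρ) := continuous_circleMap 0 ρ
  have hcont : ∀ {h : ℂ → ℂ}, DifferentiableOn ℂ h (Metric.ball 0 R) →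
      Continuous fun θ : ℝ => h (circleMap 0 ρ θ) := fun hh =>
    hh.continuousOn.comp_continuous hcirc hmem
  have hKθ : ∀ θ : ℝ, HasDerivAt (fun θ : ℝ => K (circleMap 0 ρ θ))
      (dslope g 0 (circleMap 0 ρ θ) * (circleMap 0 ρ θ * Complex.I)) θ := fun θ =>
    (hK _ (hmem θ)).comp θ (hasDerivAt_circleMap 0 ρ θ)
  -- Both endpoints of the circle are `-ρ`, so the boundary term of the integration by parts is `2π
  -- K(-ρ)`.
  have hneg : ∀ θ : ℝ, |θ| = π → circleMap 0 ρ θ = -(ρ : ℂ) := by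
    intro θ hθ
    rcases eq_or_eq_neg_of_abs_eq hθ with rfl | rfl <;>
      simp [circleMap, Complex.exp_neg]
  have hpi : circleMap 0 ρ π = -(ρ : ℂ) := hneg _ (abs_of_pos pi_pos)
  have hnpi : circleMap 0 ρ (-π) = -(ρ : ℂ) := hneg _ (by rw [abs_neg, abs_of_pos pi_pos])
  have hmean : ∫ θ in -π..π, K (circleMap 0 ρ θ) = 2 * π * K 0 := by
    have hd : DiffContOnCl ℂ K (Metric.ball 0 |ρ|) := by
      apply DifferentiableOn.diffContOnCl
      refine hKd.mono ((Metric.closure_ball_subset_closedBall).trans ?_)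
      rw [abs_of_pos h0]
      exact Metric.closedBall_subset_ball hR
    have h := hd.circleAverage
    rw [Real.circleAverage_eq_integral_add (-π),
      intervalIntegral.integral_comp_add_right (fun θ => K (circleMap 0 ρ θ))] at h
    have e : 2 * π + -π = π := by ring
    rw [zero_add, e] at h
    rw [← h, Complex.real_smul]
    push_cast
    field_simp
  have hparts : ∫ θ in -π..π, (θ : ℂ) *
        (dslope g 0 (circleMap 0 ρ θ) * (circleMap 0 ρ θ * Complex.I))
      = 2 * π * (K (-ρ) - K 0) := by
    rw [intervalIntegral.integral_mul_deriv_eq_deriv_mul (u := fun θ : ℝ => (θ : ℂ))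
      (u' := fun _ => 1) (v := fun θ : ℝ => K (circleMap 0 ρ θ))
      (fun θ _ => Complex.ofRealCLM.hasDerivAt) (fun θ _ => hKθ θ)
      (by simp) (((hcont hk).mul (hcirc.mul continuous_const)).intervalIntegrable _ _)]
    simp only [one_mul, hmean, hpi, hnpi]
    push_cast
    ring
  have hrad : K (-ρ) - K 0 = -∫ r in (0 : ℝ)..ρ, dslope g 0 (-(r : ℂ)) := by
    have hm : ∀ r ∈ uIcc 0 ρ, -(r : ℂ) ∈ Metric.ball (0 : ℂ) R := by
      intro r hr
      rw [uIcc_of_le h0.le] at hr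
      simp [abs_of_nonneg hr.1, hr.2.trans_lt hR]
    have := intervalIntegral.integral_eq_sub_of_hasDerivAt (a := 0) (b := ρ)
      (f := fun r : ℝ => K (-(r : ℂ))) (f' := fun r : ℝ => dslope g 0 (-(r : ℂ)) * (-1))
      (fun r hr => (hK _ (hm r hr)).comp r (Complex.ofRealCLM.hasDerivAt.neg)) ?_
    · rw [intervalIntegral.integral_mul_const] at this
      simp only [Complex.ofReal_zero, neg_zero] at this
      rw [← this]; ring
    · refine ContinuousOn.intervalIntegrable ?_
      exact (hk.continuousOn.comp (by fun_prop) hm).mul continuousOn_const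
  -- Write `g(z) = g(0) + z · dslope g 0 z`; the constant drops out because `θ` is odd.
  have hsplit : ∀ θ : ℝ, (θ : ℂ) * g (circleMap 0 ρ θ) = (θ : ℂ) * g 0 +
      -Complex.I * ((θ : ℂ) *
        (dslope g 0 (circleMap 0 ρ θ) * (circleMap 0 ρ θ * Complex.I))) := by
    intro θ
    have h := sub_smul_dslope g 0 (circleMap 0 ρ θ)
    rw [sub_zero, smul_eq_mul] at h
    linear_combination (-θ : ℂ) * h +
      θ * circleMap 0 ρ θ * dslope g 0 (circleMap 0 ρ θ) * Complex.I_sq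
  have hid : ∫ θ in -π..π, (θ : ℂ) = 0 := by
    rw [intervalIntegral.integral_ofReal, integral_id]
    simp
  simp_rw [hsplit]
  rw [intervalIntegral.integral_add, intervalIntegral.integral_mul_const,
    intervalIntegral.integral_const_mul, hid, hparts, hrad]
  · ring
  · exact (Continuous.intervalIntegrable (by fun_prop) _ _)
  · refine Continuous.intervalIntegrable ?_ _ _
    exact continuous_const.mul (Complex.continuous_ofReal.mul ((hcont hk).mul
      (hcirc.mul continuous_const)))

/-! ### The digamma function and Gauss's integral -/

theorem differentiableAt_log_Gamma {x : ℝ} (hx : 0 < x) :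
    DifferentiableAt ℝ (fun y : ℝ => Real.log (Real.Gamma y)) x := by
  refine (Real.differentiableAt_Gamma fun m h => ?_).log (Real.Gamma_pos_of_pos hx).ne'
  have : (0 : ℝ) ≤ m := Nat.cast_nonneg m
  linarith

theorem monotoneOn_digamma : MonotoneOn digamma (Ioi 0) :=
  Real.convexOn_log_Gamma.monotoneOn_deriv fun _ hx => differentiableAt_log_Gamma hx

theorem digamma_one : digamma 1 = -Real.eulerMascheroniConstant := by
  have h := ofReal_digamma one_pos
  rw [Complex.ofReal_one, Complex.digamma_one] at h
  exact_mod_cast h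

theorem digamma_add_one {x : ℝ} (hx : 0 < x) : digamma (x + 1) = digamma x + 1 / x := by
  have h := ofReal_digamma (x := x + 1) (by positivity)
  rw [Complex.ofReal_add, Complex.ofReal_one, Complex.digamma_apply_add_one, ← ofReal_digamma hx]
    at h
  · rw [one_div]
    exact_mod_cast h
  · intro m hm
    have h2 : x = -(m : ℝ) := by exact_mod_cast hm
    have : (0 : ℝ) ≤ m := Nat.cast_nonneg m
    linarith

theorem digamma_add_natCast {x : ℝ} (hx : 0 < x) (n : ℕ) :
    digamma (x + n) = digamma x + ∑ k ∈ Finset.range n, 1 / (x + k) := by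
  induction n with
  | zero => simp
  | succ n ih =>
    rw [Finset.sum_range_succ, ← add_assoc, ← ih, Nat.cast_succ, ← add_assoc,
      digamma_add_one (by positivity)]

/-- The Weierstrass series of the digamma function on `[1, 2]`. -/
theorem hasSum_digamma {t : ℝ} (ht : t ∈ Icc (0 : ℝ) 1) :
    HasSum (fun n : ℕ => 1 / (1 + (n : ℝ)) - 1 / (t + 1 + n))
      (digamma (t + 1) + Real.eulerMascheroniConstant) := by
  obtain ⟨h0, h1⟩ := ht
  rw [hasSum_iff_tendsto_nat_of_nonneg]
  · have key : ∀ n : ℕ, ∑ k ∈ Finset.range n, (1 / (1 + (k : ℝ)) - 1 / (t + 1 + k))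
        = digamma (t + 1) + Real.eulerMascheroniConstant
          - (digamma (t + 1 + n) - digamma (1 + n)) := by
      intro n
      rw [Finset.sum_sub_distrib, digamma_add_natCast (by positivity),
        digamma_add_natCast one_pos, digamma_one]
      ring
    simp_rw [key]
    -- Monotonicity and the recurrence squeeze the difference between `0` and `ψ(n+2) - ψ(n+1) =
    -- 1/(n+1)`; no asymptotics of `ψ` are needed.
    have hlim : Tendsto (fun n : ℕ => digamma (t + 1 + n) - digamma (1 + n)) atTop (𝓝 0) := by
      refine squeeze_zero (fun n => ?_) (fun n => ?_) tendsto_one_div_add_atTop_nhds_zero_nat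
      · have : digamma (1 + n) ≤ digamma (t + 1 + n) :=
          monotoneOn_digamma (show (0 : ℝ) < 1 + n by positivity)
            (show (0 : ℝ) < t + 1 + n by positivity) (by linarith)
        linarith
      · have : digamma (t + 1 + n) ≤ digamma (1 + n + 1) :=
          monotoneOn_digamma (show (0 : ℝ) < t + 1 + n by positivity)
            (show (0 : ℝ) < 1 + n + 1 by positivity) (by linarith)
        rw [digamma_add_one (by positivity)] at this
        rw [add_comm (n : ℝ) 1]
        linarith
    simpa using tendsto_const_nhds.sub hlim
  · intro n
    rw [sub_nonneg]
    exact one_div_le_one_div_of_le (by positivity) (by linarith)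

/-- Gauss's integral kernel `e ^ {-u} (1 - e ^ {-tu}) / (1 - e ^ {-u})`. -/
noncomputable def gaussKernel (t u : ℝ) : ℝ :=
  Real.exp (-u) * (1 - Real.exp (-(t * u))) / (1 - Real.exp (-u))

theorem one_sub_exp_neg_pos {u : ℝ} (hu : 0 < u) : 0 < 1 - Real.exp (-u) := by
  simpa using hu

theorem gaussKernel_nonneg {t u : ℝ} (ht : 0 ≤ t) (hu : 0 < u) : 0 ≤ gaussKernel t u := by
  have h1 := one_sub_exp_neg_pos hu
  have h2 : 0 ≤ 1 - Real.exp (-(t * u)) := by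
    simpa using mul_nonneg ht hu.le
  unfold gaussKernel
  positivity

/-- This bound, uniform in `t`, provides the dominating function for Fubini. -/
theorem gaussKernel_le {t u : ℝ} (ht : t ≤ 1) (hu : 0 < u) : gaussKernel t u ≤ Real.exp (-u) := by
  have h1 := one_sub_exp_neg_pos hu
  rw [gaussKernel, div_le_iff₀ h1]
  have h2 : Real.exp (-u) ≤ Real.exp (-(t * u)) := Real.exp_le_exp.2 (by nlinarith)
  gcongr

theorem integrableOn_exp_neg_mul {b : ℝ} (hb : 0 < b) :
    IntegrableOn (fun u : ℝ => Real.exp (-(b * u))) (Ioi 0) := by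
  simpa using exp_neg_integrableOn_Ioi 0 hb

theorem integral_exp_neg_mul {b : ℝ} (hb : 0 < b) :
    ∫ u in Ioi (0 : ℝ), Real.exp (-(b * u)) = 1 / b := by
  have := integral_exp_mul_Ioi (neg_lt_zero.2 hb) 0
  simpa using this

/-- Gauss's integral for the digamma function. -/
theorem integral_gaussKernel {t : ℝ} (ht : t ∈ Icc (0 : ℝ) 1) :
    ∫ u in Ioi (0 : ℝ), gaussKernel t u = digamma (t + 1) + Real.eulerMascheroniConstant := by
  have h0 := ht.1
  set F : ℕ → ℝ → ℝ := fun n u =>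
    Real.exp (-((1 + (n : ℝ)) * u)) - Real.exp (-((t + 1 + n) * u)) with hF
  have hFint : ∀ n, IntegrableOn (F n) (Ioi 0) := fun n =>
    (integrableOn_exp_neg_mul (by positivity)).sub (integrableOn_exp_neg_mul (by positivity))
  have hFval : ∀ n, ∫ u in Ioi (0 : ℝ), F n u = 1 / (1 + (n : ℝ)) - 1 / (t + 1 + n) := by
    intro n
    rw [hF, integral_sub (integrableOn_exp_neg_mul (by positivity))
      (integrableOn_exp_neg_mul (by positivity)), integral_exp_neg_mul (by positivity),
      integral_exp_neg_mul (by positivity)]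
  have hFnorm : ∀ n, ∫ u in Ioi (0 : ℝ), ‖F n u‖ = 1 / (1 + (n : ℝ)) - 1 / (t + 1 + n) := by
    intro n
    rw [← hFval n]
    refine setIntegral_congr_fun measurableSet_Ioi fun u hu => ?_
    have hu : 0 < u := hu
    refine Real.norm_of_nonneg (sub_nonneg.2 (Real.exp_le_exp.2 ?_))
    nlinarith
  have h := hasSum_integral_of_summable_integral_norm hFint
    (by simp_rw [hFnorm]; exact (hasSum_digamma ht).summable)
  simp_rw [hFval] at h
  rw [(hasSum_digamma ht).unique h]
  refine setIntegral_congr_fun measurableSet_Ioi fun u hu => ?_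
  have hu : 0 < u := hu
  -- `F n u` is the `n`-th term of a geometric series of ratio `e^{-u}` with first term `e^{-u}(1 -
  -- e^{-tu})`.
  have hs := (hasSum_geometric_of_lt_one (Real.exp_pos (-u)).le
    (by simpa using hu)).mul_left (Real.exp (-u) * (1 - Real.exp (-(t * u))))
  refine Eq.trans ?_ (hs.tsum_eq.symm.trans (tsum_congr fun n => ?_))
  · rw [gaussKernel, div_eq_mul_inv]
  · rw [hF, ← Real.exp_nat_mul, mul_sub, mul_one, sub_mul, ← Real.exp_add, ← Real.exp_add,
      ← Real.exp_add]
    congr 2 <;> ring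

/-! ### Convergence, and the integral of `cutKernel` by Fubini -/

theorem intervalIntegrable_exp_mul_digamma (a : ℝ) :
    IntervalIntegrable (fun t : ℝ => Real.exp (-(a * t)) * digamma (t + 1)) volume 0 1 := by
  have h : IntervalIntegrable (fun t : ℝ => digamma (t + 1)) volume 0 1 := by
    apply MonotoneOn.intervalIntegrable
    intro x hx y hy hxy
    rw [uIcc_of_le zero_le_one] at hx hy
    exact monotoneOn_digamma (show (0 : ℝ) < x + 1 by linarith [hx.1])
      (show (0 : ℝ) < y + 1 by linarith [hy.1]) (by linarith)
  exact h.continuousOn_mul (by fun_prop)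

theorem integrableOn_upperGamma_zero {a : ℝ} (ha : 0 < a) :
    IntegrableOn (fun t : ℝ => t ^ ((0 : ℝ) - 1) * Real.exp (-t)) (Ioi a) := by
  have h : IntegrableOn (fun t : ℝ => a⁻¹ * Real.exp (-t)) (Ioi a) :=
    (integrableOn_exp_neg_Ioi a).const_mul _
  refine h.mono' (by fun_prop) ?_
  filter_upwards [ae_restrict_mem measurableSet_Ioi] with t ht
  have ht : a < t := ht
  have h0 := ha.trans ht
  rw [zero_sub, Real.rpow_neg_one, Real.norm_of_nonneg (by positivity)]
  gcongr

theorem integrableOn_exp_neg_add_div {a : ℝ} (ha : 0 < a) :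
    IntegrableOn (fun u : ℝ => Real.exp (-(a + u)) / (a + u)) (Ioi 0) := by
  refine ((integrableOn_exp_neg_Ioi 0).const_mul a⁻¹).mono'
    (Measurable.aestronglyMeasurable (by fun_prop)) ?_
  filter_upwards [ae_restrict_mem measurableSet_Ioi] with u hu
  have hu : 0 < u := hu
  rw [Real.norm_of_nonneg (by positivity), div_eq_inv_mul]
  gcongr <;> linarith

theorem upperGamma_zero_eq (a : ℝ) :
    upperGamma 0 a = ∫ u in Ioi (0 : ℝ), Real.exp (-(a + u)) / (a + u) := by
  have h := (measurePreserving_add_left volume a).setIntegral_preimage_emb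
    (measurableEmbedding_addLeft a) (fun t : ℝ => t ^ ((0 : ℝ) - 1) * Real.exp (-t)) (Ioi a)
  rw [upperGamma, ← h]
  have e : (fun x => a + x) ⁻¹' Ioi a = Ioi 0 := by
    ext x; simp
  rw [e]
  refine setIntegral_congr_fun measurableSet_Ioi fun u _ => ?_
  simp only [zero_sub, Real.rpow_neg_one]
  rw [div_eq_inv_mul]

/-- The kernel `(1/a - 1/(a+u)) e ^ {-u} / (1 - e ^ {-u})`. -/
noncomputable def cutKernel (a u : ℝ) : ℝ :=
  (1 / a - 1 / (a + u)) * (Real.exp (-u) / (1 - Real.exp (-u)))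

theorem integral_exp_neg_mul_zero_one {b : ℝ} (hb : b ≠ 0) :
    ∫ t in (0 : ℝ)..1, Real.exp (-b * t) = (1 - Real.exp (-b)) / b := by
  rw [intervalIntegral.integral_comp_mul_left _ (neg_ne_zero.2 hb), integral_exp]
  simp
  field_simp
  ring

/-- The `t`-integral leaves `(1-e^{-a})/a - (1-e^{-(a+u)})/(a+u)`. Splitting `1 - e^{-(a+u)} =
(1-e^{-a}) + e^{-a}(1-e^{-u})` isolates a term in which the denominator `1 - e^{-u}` cancels. -/
theorem integral_exp_mul_gaussKernel {a u : ℝ} (ha : 0 < a) (hu : 0 < u) :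
    ∫ t in (0 : ℝ)..1, Real.exp (-(a * t)) * gaussKernel t u
      = (1 - Real.exp (-a)) * cutKernel a u - Real.exp (-(a + u)) / (a + u) := by
  have e : ∀ t : ℝ, Real.exp (-(a * t)) * gaussKernel t u
      = (Real.exp (-a * t) - Real.exp (-(a + u) * t))
        * (Real.exp (-u) / (1 - Real.exp (-u))) := by
    intro t
    have : Real.exp (-(a + u) * t) = Real.exp (-a * t) * Real.exp (-(t * u)) := by
      rw [← Real.exp_add]; ring_nf
    rw [this, gaussKernel, neg_mul]
    ring
  have h1 := one_sub_exp_neg_pos hu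
  have hau : 0 < a + u := by positivity
  simp_rw [e]
  rw [intervalIntegral.integral_mul_const, intervalIntegral.integral_sub
    (Continuous.intervalIntegrable (by fun_prop) _ _)
    (Continuous.intervalIntegrable (by fun_prop) _ _), integral_exp_neg_mul_zero_one ha.ne',
    integral_exp_neg_mul_zero_one hau.ne', cutKernel, neg_add,
    Real.exp_add]
  field_simp
  ring

theorem integrable_exp_mul_gaussKernel {a : ℝ} (ha : 0 ≤ a) :
    Integrable (fun p : ℝ × ℝ => Real.exp (-(a * p.1)) * gaussKernel p.1 p.2)
      ((volume.restrict (Ioc 0 1)).prod (volume.restrict (Ioi 0))) := by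
  have h1 : Integrable (fun _ : ℝ => (1 : ℝ)) (volume.restrict (Ioc (0 : ℝ) 1)) :=
    integrable_const 1
  refine (h1.mul_prod (integrableOn_exp_neg_Ioi 0)).mono'
    (Measurable.aestronglyMeasurable (by unfold gaussKernel; fun_prop)) ?_
  rw [Measure.prod_restrict]
  filter_upwards [ae_restrict_mem (measurableSet_Ioc.prod measurableSet_Ioi)] with p hp
  obtain ⟨⟨h0, h1⟩, hu⟩ := hp
  have hk := gaussKernel_nonneg h0.le hu
  rw [Real.norm_of_nonneg (by positivity)]
  have : Real.exp (-(a * p.1)) ≤ 1 := by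
    simpa using mul_nonneg ha h0.le
  exact mul_le_mul this (gaussKernel_le h1 hu) hk zero_le_one

/-- Solving the previous identity for `cutKernel` expresses it through integrable functions. -/
theorem integrableOn_cutKernel {a : ℝ} (ha : 0 < a) : IntegrableOn (cutKernel a) (Ioi 0) := by
  have h1 := one_sub_exp_neg_pos ha
  have h := ((integrable_exp_mul_gaussKernel ha.le).integral_prod_right.add
    (integrableOn_exp_neg_add_div ha)).const_mul (1 - Real.exp (-a))⁻¹
  refine IntegrableOn.congr_fun h (fun u hu => ?_) measurableSet_Ioi
  simp only [Pi.add_apply]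
  rw [← intervalIntegral.integral_of_le zero_le_one, integral_exp_mul_gaussKernel ha hu]
  field_simp
  ring

theorem integral_cutKernel {a : ℝ} (ha : 0 < a) :
    ∫ u in Ioi (0 : ℝ), cutKernel a u
      = Real.eulerMascheroniConstant / a + (upperGamma 0 a
        + ∫ t in (0 : ℝ)..1, Real.exp (-(a * t)) * digamma (t + 1)) / (1 - Real.exp (-a)) := by
  have h1 := one_sub_exp_neg_pos ha
  have hswap := integral_integral_swap (f := fun t u => Real.exp (-(a * t)) * gaussKernel t u)
    (integrable_exp_mul_gaussKernel ha.le)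
  have hl : ∫ t in Ioc (0 : ℝ) 1, ∫ u in Ioi (0 : ℝ), Real.exp (-(a * t)) * gaussKernel t u
      = (∫ t in (0 : ℝ)..1, Real.exp (-(a * t)) * digamma (t + 1))
        + Real.eulerMascheroniConstant * ((1 - Real.exp (-a)) / a) := by
    have e : ∫ t in (0 : ℝ)..1, Real.exp (-(a * t)) = (1 - Real.exp (-a)) / a := by
      simpa using integral_exp_neg_mul_zero_one ha.ne'
    rw [← e, ← intervalIntegral.integral_const_mul, ← intervalIntegral.integral_add
      (intervalIntegrable_exp_mul_digamma a) (Continuous.intervalIntegrable (by fun_prop) _ _),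
      intervalIntegral.integral_of_le zero_le_one]
    refine setIntegral_congr_fun measurableSet_Ioc fun t ht => ?_
    rw [integral_const_mul, integral_gaussKernel ⟨ht.1.le, ht.2⟩]
    ring
  have hr : ∫ u in Ioi (0 : ℝ), ∫ t in Ioc (0 : ℝ) 1, Real.exp (-(a * t)) * gaussKernel t u
      = (1 - Real.exp (-a)) * (∫ u in Ioi (0 : ℝ), cutKernel a u) - upperGamma 0 a := by
    rw [upperGamma_zero_eq, ← integral_const_mul,
      ← integral_sub ((integrableOn_cutKernel ha).const_mul _) (integrableOn_exp_neg_add_div ha)]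
    refine setIntegral_congr_fun measurableSet_Ioi fun u hu => ?_
    rw [← intervalIntegral.integral_of_le zero_le_one, integral_exp_mul_gaussKernel ha hu]
  rw [hl, hr] at hswap
  field_simp at hswap ⊢
  linarith

/-! ### First moment on the unit circle, singular at `-1` -/

theorem one_add_mem_slitPlane {z : ℂ} (hz : ‖z‖ ≤ 1) (h : z ≠ -1) : 1 + z ∈ Complex.slitPlane := by
  rw [Complex.mem_slitPlane_iff]
  by_contra! hc
  obtain ⟨hre, him⟩ := hc
  simp only [Complex.add_re, Complex.one_re, Complex.add_im, Complex.one_im, zero_add] at hre him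
  have h1 : -1 ≤ z.re := by
    have := (abs_le.1 (Complex.abs_re_le_norm z)).1
    linarith
  exact h (Complex.ext (by simp; linarith) (by simp [him]))

theorem isOpen_one_add_slitPlane : IsOpen {z : ℂ | 1 + z ∈ Complex.slitPlane} :=
  Complex.isOpen_slitPlane.preimage (by fun_prop)

theorem circleMap_one_ne_neg_one {θ : ℝ} (hθ : θ ∈ Ioo (-π) π) : circleMap 0 1 θ ≠ -1 := by
  intro h
  have h2 : Complex.arg (Complex.exp (θ * Complex.I)) = θ := by
    rw [Complex.arg_exp_mul_I, toIocMod_eq_self]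
    constructor <;> linarith [hθ.1, hθ.2]
  rw [circleMap_zero, Complex.ofReal_one, one_mul] at h
  rw [h, Complex.arg_neg_one] at h2
  exact hθ.2.ne' h2

theorem ae_mem_Ioo_of_mem_uIoc {a b : ℝ} (hab : a ≤ b) : ∀ᵐ x : ℝ, x ∈ uIoc a b → x ∈ Ioo a b := by
  filter_upwards [Measure.ae_ne volume b] with x hx h
  rw [uIoc_of_le hab] at h
  exact ⟨h.1, lt_of_le_of_ne h.2 hx⟩

theorem intervalIntegrable_of_continuousOn_Ioo_of_norm_le {E : Type*} [NormedAddCommGroup E]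
    {f : ℝ → E} {a b C : ℝ} (hab : a ≤ b)
    (hf : ContinuousOn f (Ioo a b)) (hC : ∀ x ∈ Ioo a b, ‖f x‖ ≤ C) :
    IntervalIntegrable f volume a b := by
  rw [intervalIntegrable_iff_integrableOn_Ioo_of_le hab]
  exact IntegrableOn.of_bound (by simp) (hf.aestronglyMeasurable measurableSet_Ioo) C
    ((ae_restrict_mem measurableSet_Ioo).mono hC)

/-- The boundary case of `integral_mul_circleMap`: `g` may be singular, but bounded, at `-1`. -/
theorem integral_mul_circleMap_one {g : ℂ → ℂ} {C : ℝ}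
    (hg : DifferentiableOn ℂ g {z | 1 + z ∈ Complex.slitPlane})
    (hC : ∀ z : ℂ, ‖z‖ ≤ 1 → z ≠ -1 → ‖g z‖ ≤ C) :
    IntervalIntegrable (fun θ : ℝ => (θ : ℂ) * g (circleMap 0 1 θ)) volume (-π) π ∧
    ∫ θ in -π..π, (θ : ℂ) * g (circleMap 0 1 θ)
      = 2 * π * Complex.I * ∫ r in (0 : ℝ)..1, dslope g 0 (-(r : ℂ)) := by
  have hpi : -π ≤ π := by linarith [pi_pos]
  have hball : Metric.ball (0 : ℂ) 1 ⊆ {z | 1 + z ∈ Complex.slitPlane} := by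
    intro z hz
    rw [mem_ball_zero_iff] at hz
    refine one_add_mem_slitPlane hz.le ?_
    rintro rfl
    simp at hz
  have hgat : ∀ z : ℂ, 1 + z ∈ Complex.slitPlane → ContinuousAt g z := fun z hz =>
    (hg.differentiableAt (isOpen_one_add_slitPlane.mem_nhds hz)).continuousAt
  have hC0 : 0 ≤ C := (norm_nonneg _).trans (hC 0 (by simp) (by simp))
  have hslit : ∀ θ ∈ Ioo (-π) π, 1 + circleMap 0 1 θ ∈ Complex.slitPlane := fun θ hθ =>
    one_add_mem_slitPlane (by simp) (circleMap_one_ne_neg_one hθ)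
  have hbd : ∀ θ ∈ Ioo (-π) π, ∀ z : ℂ, ‖z‖ ≤ 1 → z ≠ -1 → ‖(θ : ℂ) * g z‖ ≤ π * C := by
    intro θ hθ z hz hz'
    rw [norm_mul, Complex.norm_real, Real.norm_eq_abs]
    exact mul_le_mul (abs_le.2 ⟨hθ.1.le, hθ.2.le⟩) (hC z hz hz') (norm_nonneg _) pi_pos.le
  have hdint : IntervalIntegrable (fun r : ℝ => dslope g 0 (-(r : ℂ))) volume 0 1 := by
    have hk : ContinuousOn (dslope g 0) (Metric.ball 0 1) :=
      ((Complex.differentiableOn_dslope (Metric.ball_mem_nhds _ one_pos)).2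
        (hg.mono hball)).continuousOn
    have hk' : ContinuousOn (fun r : ℝ => dslope g 0 (-(r : ℂ))) (Ico 0 1) := by
      refine hk.comp (by fun_prop) fun r hr => ?_
      simp [abs_of_nonneg hr.1, hr.2]
    -- Near `0` the slope is continuous; near `1` the bound on `g` controls it, since the
    -- denominator is at least `1/2`.
    refine IntervalIntegrable.trans (b := 1 / 2) ?_ ?_
    · refine ContinuousOn.intervalIntegrable (hk'.mono ?_)
      rw [uIcc_of_le (by norm_num)]
      exact fun r hr => ⟨hr.1, hr.2.trans_lt (by norm_num)⟩
    · refine intervalIntegrable_of_continuousOn_Ioo_of_norm_le (C := (C + C) / (1 / 2))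
        (by norm_num) (hk'.mono fun r hr => ⟨by linarith [hr.1], hr.2⟩) fun r hr => ?_
      have hr0 : 0 < r := by linarith [hr.1]
      have hrn : ‖-(r : ℂ)‖ = r := by simp [abs_of_pos hr0]
      rw [dslope_of_ne _ (by simpa using hr0.ne'), slope_def_field, sub_zero, norm_div, hrn]
      have h1 : ‖g (-(r : ℂ)) - g 0‖ ≤ C + C := by
        refine (norm_sub_le _ _).trans (add_le_add (hC _ (by rw [hrn]; exact hr.2.le) ?_)
          (hC 0 (by simp) (by simp)))
        rw [Ne, neg_inj]
        exact_mod_cast hr.2.ne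
      exact div_le_div₀ (by positivity) h1 (by norm_num) hr.1.le
  refine ⟨?_, ?_⟩
  · refine intervalIntegrable_of_continuousOn_Ioo_of_norm_le (C := π * C) hpi ?_ fun θ hθ =>
      hbd θ hθ _ (by simp) (circleMap_one_ne_neg_one hθ)
    refine ContinuousOn.mul (by fun_prop) ?_
    exact hg.continuousOn.comp (continuous_circleMap 0 1).continuousOn hslit
  -- Let `ρ → 1⁻` in the formula on smaller circles, with dominating constant `π * C`.
  · have hev : ∀ᶠ ρ : ℝ in 𝓝[<] 1, ρ ∈ Ioo (0 : ℝ) 1 := Ioo_mem_nhdsLT one_pos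
    have hL : Tendsto (fun ρ : ℝ => ∫ θ in -π..π, (θ : ℂ) * g (circleMap 0 ρ θ)) (𝓝[<] 1)
        (𝓝 (∫ θ in -π..π, (θ : ℂ) * g (circleMap 0 1 θ))) := by
      refine intervalIntegral.tendsto_integral_filter_of_dominated_convergence (fun _ => π * C)
        ?_ ?_ (by simp) ?_
      · filter_upwards [hev] with ρ hρ
        refine Continuous.aestronglyMeasurable (Complex.continuous_ofReal.mul ?_)
        refine (hg.mono hball).continuousOn.comp_continuous (continuous_circleMap 0 ρ) fun θ => ?_
        simp [abs_of_pos hρ.1, hρ.2]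
      · filter_upwards [hev] with ρ hρ
        filter_upwards [ae_mem_Ioo_of_mem_uIoc hpi] with θ hθ h
        have hn : ‖circleMap 0 ρ θ‖ = ρ := by simp [abs_of_pos hρ.1]
        refine hbd θ (hθ h) _ (hn.trans_le hρ.2.le) fun h' => ?_
        rw [h'] at hn
        simp only [norm_neg, norm_one] at hn
        exact hρ.2.ne' hn
      · filter_upwards [ae_mem_Ioo_of_mem_uIoc hpi] with θ hθ h
        have hc : ContinuousAt (fun ρ : ℝ => g (circleMap 0 ρ θ)) 1 := by
          refine ContinuousAt.comp (f := fun ρ : ℝ => circleMap 0 ρ θ) (hgat _ (hslit θ (hθ h))) ?_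
          simp only [circleMap_zero]
          fun_prop
        exact (continuousAt_const.mul hc).tendsto.mono_left nhdsWithin_le_nhds
    have hR : Tendsto (fun ρ : ℝ => ∫ r in (0 : ℝ)..ρ, dslope g 0 (-(r : ℂ))) (𝓝[<] 1)
        (𝓝 (∫ r in (0 : ℝ)..1, dslope g 0 (-(r : ℂ)))) := by
      have h := intervalIntegral.continuousOn_primitive_interval' hdint left_mem_uIcc 1
        right_mem_uIcc
      rw [uIcc_of_le zero_le_one] at h
      refine h.tendsto.mono_left ?_
      rw [← nhdsWithin_Ioo_eq_nhdsLT one_pos]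
      exact nhdsWithin_mono _ Ioo_subset_Icc_self
    refine tendsto_nhds_unique (hL.congr' ?_) (hR.const_mul _)
    filter_upwards [hev] with ρ hρ
    exact integral_mul_circleMap (hg.mono hball) hρ.1 hρ.2

/-! ### Removing the pole -/

/-- `1 / (log (1 + z) - a)` minus its principal part at its only pole. -/
theorem exists_differentiableOn_inv_log_sub (a : ℝ) :
    ∃ g : ℂ → ℂ, DifferentiableOn ℂ g {z | 1 + z ∈ Complex.slitPlane} ∧
      ∀ z : ℂ, z ≠ Real.exp a - 1 → g z = 1 / (Complex.log (1 + z) - a)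
        - Real.exp a / (z - (Real.exp a - 1)) := by
  set z₀ : ℂ := Real.exp a - 1 with hz₀
  set U : Set ℂ := {z | 1 + z ∈ Complex.slitPlane} with hU
  have h10 : 1 + z₀ = (Real.exp a : ℂ) := by rw [hz₀]; ring
  have hz₀U : z₀ ∈ U := by
    rw [hU, mem_ofPred_eq, h10]
    exact Complex.ofReal_mem_slitPlane.2 (Real.exp_pos a)
  have hlog : Complex.log (1 + z₀) = a := by
    rw [h10, ← Complex.ofReal_log (Real.exp_pos a).le, Real.log_exp]
  have hnhds := isOpen_one_add_slitPlane.mem_nhds hz₀U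
  set ℓ : ℂ → ℂ := fun z => Complex.log (1 + z) with hℓ
  have hd : ∀ z ∈ U, HasDerivAt ℓ (1 / (1 + z)) z := fun z hz =>
    ((hasDerivAt_id z).const_add 1).clog hz
  have hq : DifferentiableOn ℂ (dslope ℓ z₀) U :=
    (Complex.differentiableOn_dslope hnhds).2 fun z hz =>
      (hd z hz).differentiableAt.differentiableWithinAt
  have hq₀ : dslope ℓ z₀ z₀ = (Real.exp a : ℂ)⁻¹ := by
    rw [dslope_same, (hd z₀ hz₀U).deriv, h10, one_div]
  have hqne : ∀ z ≠ z₀, dslope ℓ z₀ z = (Complex.log (1 + z) - a) / (z - z₀) := by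
    intro z hz
    rw [dslope_of_ne _ hz, slope_def_field, hℓ]
    simp only [hlog]
  have hne : ∀ z ∈ U, dslope ℓ z₀ z ≠ 0 := by
    intro z hz
    by_cases h : z = z₀
    · rw [h, hq₀]
      exact inv_ne_zero (by exact_mod_cast (Real.exp_pos a).ne')
    · rw [hqne z h]
      refine div_ne_zero (sub_ne_zero.2 fun hl => h ?_) (sub_ne_zero.2 h)
      have := congrArg Complex.exp hl
      rw [Complex.exp_log (Complex.slitPlane_ne_zero hz)] at this
      rw [hz₀, Complex.ofReal_exp, ← this]
      ring
  -- With `q = dslope ℓ z₀`, `1/(ℓ - a) = q⁻¹/(z - z₀)` and `q⁻¹(z₀) = e^a`; subtracting the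
  -- principal part leaves exactly the slope of `q⁻¹` at `z₀`.
  refine ⟨dslope (fun z => (dslope ℓ z₀ z)⁻¹) z₀,
    (Complex.differentiableOn_dslope hnhds).2 (hq.fun_inv hne), fun z hz => ?_⟩
  have hz' := sub_ne_zero.2 hz
  rw [dslope_of_ne _ hz, slope_def_field, hqne z hz, hq₀, inv_inv, inv_div, sub_div, div_div,
    mul_comm, ← div_div, div_self hz']

/-! ### The substitution on the negative radius -/

theorem image_one_sub_exp_neg : (fun u : ℝ => 1 - Real.exp (-u)) '' Ioi 0 = Ioo 0 1 := by
  ext r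
  constructor
  · rintro ⟨u, hu, rfl⟩
    exact ⟨one_sub_exp_neg_pos hu, by simpa using Real.exp_pos (-u)⟩
  · rintro ⟨h0, h1⟩
    refine ⟨-Real.log (1 - r), ?_, ?_⟩
    · have := Real.log_neg (x := 1 - r) (by linarith) (by linarith)
      simpa using this
    · simp only [neg_neg]
      rw [Real.exp_log (by linarith)]
      ring

theorem hasDerivAt_one_sub_exp_neg (u : ℝ) :
    HasDerivAt (fun u : ℝ => 1 - Real.exp (-u)) (Real.exp (-u)) u := by
  simpa using ((hasDerivAt_neg u).exp.const_sub 1)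

theorem injective_one_sub_exp_neg : Function.Injective fun u : ℝ => 1 - Real.exp (-u) := by
  intro u v h
  simpa using h

theorem abs_deriv_smul_cut (a u : ℝ) :
    |Real.exp (-u)| • ((1 / a - 1 / (a - Real.log (1 - (1 - Real.exp (-u)))))
      / (1 - Real.exp (-u))) = cutKernel a u := by
  rw [abs_of_pos (Real.exp_pos _), sub_sub_cancel, Real.log_exp, sub_neg_eq_add, smul_eq_mul,
    cutKernel]
  ring

/-- The substitution `r = 1 - e ^ {-u}`. -/
theorem integral_cut (a : ℝ) :
    ∫ r in (0 : ℝ)..1, (1 / a - 1 / (a - Real.log (1 - r))) / r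
      = ∫ u in Ioi (0 : ℝ), cutKernel a u := by
  rw [intervalIntegral.integral_of_le zero_le_one, integral_Ioc_eq_integral_Ioo,
    ← image_one_sub_exp_neg, integral_image_eq_integral_abs_deriv_smul measurableSet_Ioi
      (fun u _ => (hasDerivAt_one_sub_exp_neg u).hasDerivWithinAt)
      injective_one_sub_exp_neg.injOn]
  simp_rw [abs_deriv_smul_cut]

theorem intervalIntegrable_cut {a : ℝ} (ha : 0 < a) :
    IntervalIntegrable (fun r : ℝ => (1 / a - 1 / (a - Real.log (1 - r))) / r) volume 0 1 := by
  rw [intervalIntegrable_iff_integrableOn_Ioo_of_le zero_le_one, ← image_one_sub_exp_neg,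
    integrableOn_image_iff_integrableOn_abs_deriv_smul measurableSet_Ioi
      (fun u _ => (hasDerivAt_one_sub_exp_neg u).hasDerivWithinAt)
      injective_one_sub_exp_neg.injOn]
  simp_rw [abs_deriv_smul_cut]
  exact integrableOn_cutKernel ha

/-! ### Bounds near `-1` and the pole term -/

/-- For `|1+z| ≤ 1` the real part of `log(1+z) - a` is at most `-a`, even as `z → -1`. -/
theorem norm_inv_log_sub_le {a : ℝ} (ha : 0 < a) {z : ℂ} (hz : ‖1 + z‖ ≤ 1) :
    ‖1 / (Complex.log (1 + z) - a)‖ ≤ 1 / a := by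
  rw [norm_div, norm_one]
  refine one_div_le_one_div_of_le ha ?_
  refine le_trans ?_ (Complex.abs_re_le_norm _)
  rw [Complex.sub_re, Complex.log_re, Complex.ofReal_re, le_abs]
  right
  linarith [Real.log_nonpos (norm_nonneg _) hz]

/-- The part of the closed disc with `|1+z| ≥ 1` is compact and avoids `-1`. On the rest, `Re z < 0`
keeps `z` at distance at least `e^a - 1` from the pole, and the logarithmic term is at most `1/a`.
-/
theorem exists_norm_le_of_eq {a : ℝ} (ha : 0 < a) {g : ℂ → ℂ}
    (hg : ContinuousOn g {z | 1 + z ∈ Complex.slitPlane})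
    (hgz : ∀ z : ℂ, z ≠ Real.exp a - 1 → g z = 1 / (Complex.log (1 + z) - a)
        - Real.exp a / (z - (Real.exp a - 1))) :
    ∃ C, ∀ z : ℂ, ‖z‖ ≤ 1 → z ≠ -1 → ‖g z‖ ≤ C := by
  have hc : IsCompact (Metric.closedBall (0 : ℂ) 1 ∩ {z | 1 ≤ ‖1 + z‖}) :=
    (isCompact_closedBall 0 1).inter_right (isClosed_le continuous_const (by fun_prop))
  obtain ⟨C, hC⟩ := hc.exists_bound_of_continuousOn (f := g) <| hg.mono fun z hz => by
    refine one_add_mem_slitPlane (by simpa using hz.1) ?_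
    rintro rfl
    have := hz.2
    norm_num at this
  have hb0 : 0 < Real.exp a - 1 := by simpa using ha
  refine ⟨max C (1 / a + Real.exp a / (Real.exp a - 1)), fun z hz hz' => ?_⟩
  rcases le_or_gt 1 ‖1 + z‖ with h | h
  · exact (hC z ⟨by simpa using hz, h⟩).trans (le_max_left _ _)
  · have hre : z.re < 0 := by
      have := (Complex.re_le_norm (1 + z)).trans_lt h
      rw [Complex.add_re, Complex.one_re] at this
      linarith
    have hle : Real.exp a - 1 ≤ ‖z - ((Real.exp a : ℂ) - 1)‖ := by
      have := (Complex.abs_re_le_norm (z - ((Real.exp a : ℂ) - 1)))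
      rw [Complex.sub_re, Complex.sub_re, Complex.ofReal_re, Complex.one_re, abs_le] at this
      linarith
    have hne : z ≠ (Real.exp a : ℂ) - 1 := by
      rintro rfl
      rw [sub_self, norm_zero] at hle
      linarith
    refine le_trans ?_ (le_max_right _ _)
    rw [hgz z hne]
    refine (norm_sub_le _ _).trans (add_le_add (norm_inv_log_sub_le ha h.le) ?_)
    rw [norm_div, Complex.norm_real, Real.norm_of_nonneg (Real.exp_pos a).le]
    gcongr

/-- The reflection `θ ↦ -θ` replaces `1/(z - b)` by `z/(1 - bz)`, holomorphic on the larger disc of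
radius `1/b > 1`, at the cost of a sign; the radial formula then applies. -/
theorem integral_mul_inv_circleMap_sub {b : ℝ} (hb0 : 0 < b) (hb : b < 1) :
    ∫ θ in -π..π, (θ : ℂ) * (1 / (circleMap 0 1 θ - b))
      = -(2 * π * Complex.I * (Real.log (1 + b) / b : ℝ)) := by
  set h : ℂ → ℂ := fun w => w / (1 - b * w) with hh
  have hne : ∀ w ∈ Metric.ball (0 : ℂ) (1 / b), 1 - b * w ≠ 0 := by
    intro w hw h0
    rw [mem_ball_zero_iff, lt_div_iff₀ hb0] at hw
    have : ‖(b : ℂ) * w‖ = 1 := by rw [← sub_eq_zero.1 h0, norm_one]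
    rw [norm_mul, Complex.norm_real, Real.norm_of_nonneg hb0.le] at this
    linarith
  have hd : DifferentiableOn ℂ h (Metric.ball 0 (1 / b)) := by
    refine DifferentiableOn.div (by fun_prop) (by fun_prop) hne
  have key := integral_mul_circleMap hd one_pos (by rwa [lt_div_iff₀ hb0, one_mul])
  have hk : ∫ r in (0 : ℝ)..1, dslope h 0 (-(r : ℂ)) = (Real.log (1 + b) / b : ℝ) := by
    have e : ∫ r in (0 : ℝ)..1, (1 + b * r)⁻¹ = Real.log (1 + b) / b := by
      rw [intervalIntegral.integral_comp_add_mul (fun x => x⁻¹) hb0.ne', integral_inv_of_pos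
        (by positivity) (by positivity), smul_eq_mul]
      simp
      ring
    rw [← e, ← intervalIntegral.integral_ofReal]
    refine intervalIntegral.integral_congr_ae (ae_of_all _ fun r hr => ?_)
    rw [uIoc_of_le zero_le_one] at hr
    have hr0 : (r : ℂ) ≠ 0 := by exact_mod_cast hr.1.ne'
    rw [dslope_of_ne _ (neg_ne_zero.2 hr0), slope_def_field, hh]
    have : (1 + b * r : ℂ) ≠ 0 := by
      have : (0 : ℝ) < 1 + b * r := by have := hr.1; positivity
      exact_mod_cast this.ne'
    push_cast
    simp only [zero_div, sub_zero, mul_neg, sub_neg_eq_add]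
    field_simp
  rw [hk] at key
  have hrefl := intervalIntegral.integral_comp_neg (a := -π) (b := π)
    fun θ : ℝ => (θ : ℂ) * h (circleMap 0 1 θ)
  rw [neg_neg] at hrefl
  rw [← key, ← hrefl, ← intervalIntegral.integral_neg]
  refine intervalIntegral.integral_congr fun θ _ => ?_
  have hinv : circleMap 0 1 (-θ) = (circleMap 0 1 θ)⁻¹ := by
    simp [circleMap_zero, Complex.exp_neg]
  have h0 : circleMap 0 1 θ ≠ 0 := circleMap_ne_center one_ne_zero
  have hn : circleMap 0 1 θ - b ≠ 0 := by
    intro hz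
    have := congrArg norm (sub_eq_zero.1 hz)
    rw [Complex.norm_real, Real.norm_of_nonneg hb0.le] at this
    simp at this
    exact hb.ne this.symm
  simp only [hh, hinv]
  push_cast
  have e : (circleMap 0 1 θ)⁻¹ / (1 - b * (circleMap 0 1 θ)⁻¹) = 1 / (circleMap 0 1 θ - b) := by
    rw [show 1 - b * (circleMap 0 1 θ)⁻¹ = (circleMap 0 1 θ - b) * (circleMap 0 1 θ)⁻¹ by
      rw [sub_mul, mul_inv_cancel₀ h0]]
    rw [div_mul_cancel_right₀ (inv_ne_zero h0), one_div]
  rw [e]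
  ring

/-! ### The integrand as an imaginary part, and `M(a)` -/

theorem intervalIntegrable_integrand (a : ℝ) : IntervalIntegrable (integrand a) volume 0 (π / 2) := by
  rw [intervalIntegrable_iff_integrableOn_Ioc_of_le (by positivity)]
  refine IntegrableOn.of_bound (by simp) (Measurable.aestronglyMeasurable ?_) 1 ?_
  · unfold integrand
    fun_prop
  · refine ae_of_all _ fun x => ?_
    rw [integrand, Real.norm_of_nonneg (by positivity)]
    exact div_le_one_of_le₀ (by linarith [sq_nonneg (Real.log (2 * Real.exp (-a) * Real.cos x))])
      (by positivity)

theorem one_add_circleMap (θ : ℝ) :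
    1 + circleMap 0 1 θ = (2 * Real.cos (θ / 2) : ℝ) * Complex.exp ((θ / 2 : ℝ) * Complex.I) := by
  have h : Complex.exp (θ * Complex.I) = Complex.exp ((θ / 2 : ℝ) * Complex.I) ^ 2 := by
    rw [← Complex.exp_nat_mul]
    push_cast
    ring_nf
  have h2 : Complex.exp (-((θ / 2 : ℝ) * Complex.I)) * Complex.exp ((θ / 2 : ℝ) * Complex.I) = 1 := by
    rw [← Complex.exp_add, neg_add_cancel, Complex.exp_zero]
  rw [circleMap_zero, Complex.ofReal_one, one_mul, h, Complex.ofReal_mul, Complex.ofReal_cos,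
    Complex.ofReal_ofNat, Complex.two_cos]
  rw [neg_mul]
  linear_combination -h2

theorem log_one_add_circleMap {θ : ℝ} (hθ : θ ∈ Ioo (-π) π) :
    Complex.log (1 + circleMap 0 1 θ) = Real.log (2 * Real.cos (θ / 2)) + (θ / 2 : ℝ) * Complex.I := by
  have hcos : 0 < 2 * Real.cos (θ / 2) :=
    mul_pos two_pos (Real.cos_pos_of_mem_Ioo ⟨by linarith [hθ.1], by linarith [hθ.2]⟩)
  rw [one_add_circleMap, Complex.log_ofReal_mul hcos (Complex.exp_ne_zero _), Complex.log_exp]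
  · simp; linarith [hθ.1, pi_pos]
  · simp; linarith [hθ.2, pi_pos]

theorem im_mul_inv_log_sub (a : ℝ) {θ : ℝ} (hθ : θ ∈ Ioo (-π) π) :
    ((θ : ℂ) * (1 / (Complex.log (1 + circleMap 0 1 θ) - a))).im = -2 * integrand a (θ / 2) := by
  have hcos : 0 < Real.cos (θ / 2) :=
    Real.cos_pos_of_mem_Ioo ⟨by linarith [hθ.1], by linarith [hθ.2]⟩
  have hl : Real.log (2 * Real.exp (-a) * Real.cos (θ / 2))
      = Real.log (2 * Real.cos (θ / 2)) - a := by
    rw [mul_right_comm, Real.log_mul (by positivity) (Real.exp_pos _).ne', Real.log_exp]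
    ring
  rw [log_one_add_circleMap hθ, integrand, hl, Complex.im_ofReal_mul, one_div, Complex.inv_im,
    Complex.normSq_apply]
  simp
  ring

theorem integral_integrand_half (a : ℝ) :
    ∫ θ in -π..π, -2 * integrand a (θ / 2) = -8 * ∫ x in (0 : ℝ)..(π / 2), integrand a x := by
  have heven : ∀ x, integrand a (-x) = integrand a x := fun x => by simp [integrand]
  have hI := intervalIntegrable_integrand a
  have hneg : ∫ x in -(π / 2)..0, integrand a x = ∫ x in (0 : ℝ)..(π / 2), integrand a x := by
    have := intervalIntegral.integral_comp_neg (a := 0) (b := π / 2) (integrand a)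
    simp_rw [heven] at this
    rw [this, neg_zero]
  have hI' : IntervalIntegrable (integrand a) volume (-(π / 2)) 0 := by
    have := (IntervalIntegrable.iff_comp_neg (f := integrand a) (a := 0) (b := π / 2)).1 hI
    simp_rw [heven] at this
    simpa using this.symm
  rw [intervalIntegral.integral_const_mul, intervalIntegral.integral_comp_div _ two_ne_zero,
    neg_div, ← intervalIntegral.integral_add_adjacent_intervals hI' hI, hneg, smul_eq_mul]
  ring

theorem M_eq {a : ℝ} (ha0 : 0 < a) (ha : a < Real.log 2) :
    M a = (a + Real.log (1 - Real.exp (-a))) / (1 - Real.exp (-a))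
      + ∫ u in Ioi (0 : ℝ), cutKernel a u := by
  have hpi : -π ≤ π := by linarith [pi_pos]
  set b : ℝ := Real.exp a - 1 with hb
  have hb0 : 0 < b := by simpa [hb] using ha0
  have hb1 : b < 1 := by
    have := (Real.lt_log_iff_exp_lt two_pos).1 ha
    linarith
  have hbC : (Real.exp a : ℂ) - 1 = (b : ℂ) := by rw [hb]; push_cast; rfl
  obtain ⟨g, hg, hgz⟩ := exists_differentiableOn_inv_log_sub a
  obtain ⟨C, hC⟩ := exists_norm_le_of_eq ha0 hg.continuousOn hgz
  obtain ⟨hgi, hgint⟩ := integral_mul_circleMap_one hg hC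
  rw [hbC] at hgz
  have hne : ∀ θ : ℝ, circleMap 0 1 θ ≠ (b : ℂ) := by
    intro θ h
    have := congrArg norm h
    rw [Complex.norm_real, Real.norm_of_nonneg hb0.le] at this
    simp at this
    exact hb1.ne this.symm
  set J := ∫ u in Ioi (0 : ℝ), cutKernel a u with hJ
  -- At `-r` the logarithmic part of `g` contributes the cut integrand with a minus sign, the
  -- subtracted pole contributes `(e^a/b)/(b + r)`.
  have hd : ∫ r in (0 : ℝ)..1, dslope g 0 (-(r : ℂ))
      = (-(J - Real.exp a / b * (a - Real.log b)) : ℝ) := by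
    have e1 : ∫ r in (0 : ℝ)..1, (b + r)⁻¹ = a - Real.log b := by
      rw [intervalIntegral.integral_comp_add_left (fun x => x⁻¹), integral_inv_of_pos
        (by positivity) (by positivity), Real.log_div (by positivity) (by positivity), hb]
      simp
    have e2 : IntervalIntegrable (fun r : ℝ => (b + r)⁻¹) volume 0 1 := by
      refine ContinuousOn.intervalIntegrable (ContinuousOn.inv₀ (by fun_prop) fun r hr => ?_)
      rw [uIcc_of_le zero_le_one] at hr
      linarith [hr.1]
    rw [hJ, ← integral_cut, ← e1, ← intervalIntegral.integral_const_mul,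
      ← intervalIntegral.integral_sub (intervalIntegrable_cut ha0) (e2.const_mul _),
      ← intervalIntegral.integral_neg, ← intervalIntegral.integral_ofReal]
    refine intervalIntegral.integral_congr_ae ?_
    filter_upwards [ae_mem_Ioo_of_mem_uIoc zero_le_one] with r hr' hr
    obtain ⟨h0, h1⟩ := hr' hr
    have hr0 : (r : ℂ) ≠ 0 := by exact_mod_cast h0.ne'
    have hrb : -(r : ℂ) ≠ b := by
      intro h
      have : -r = b := by exact_mod_cast h
      linarith
    have hlog : Complex.log (1 + -(r : ℂ)) = (Real.log (1 - r) : ℝ) := by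
      rw [Complex.ofReal_log (by linarith)]
      push_cast
      ring_nf
    have h0b : (0 : ℂ) ≠ b := by exact_mod_cast hb0.ne
    rw [dslope_of_ne _ (neg_ne_zero.2 hr0), slope_def_field, hgz _ hrb, hgz _ h0b, hlog]
    have hl : a - Real.log (1 - r) ≠ 0 := by
      have := Real.log_neg (x := 1 - r) (by linarith) (by linarith)
      linarith
    have hbr : b + r ≠ 0 := by positivity
    rw [add_zero, Complex.log_one]
    norm_cast
    rw [← neg_sub a (Real.log (1 - r)), show -r - b = -(b + r) by ring, zero_sub, zero_sub,
      sub_zero]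
    generalize a - Real.log (1 - r) = y at hl
    have ha' := ha0.ne'
    have hb' := hb0.ne'
    have hr' := h0.ne'
    clear_value b
    field_simp
    ring
  have hpole := integral_mul_inv_circleMap_sub hb0 hb1
  have hpi' : IntervalIntegrable (fun θ : ℝ => (θ : ℂ) * (1 / (circleMap 0 1 θ - b))) volume (-π) π := by
    refine Continuous.intervalIntegrable (Complex.continuous_ofReal.mul ?_) _ _
    exact continuous_const.div ((continuous_circleMap 0 1).sub continuous_const)
      fun θ => sub_ne_zero.2 (hne θ)
  have hsum : ∀ θ : ℝ, (θ : ℂ) * (1 / (Complex.log (1 + circleMap 0 1 θ) - a))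
      = (θ : ℂ) * g (circleMap 0 1 θ)
        + Real.exp a * ((θ : ℂ) * (1 / (circleMap 0 1 θ - b))) := by
    intro θ
    rw [hgz _ (hne θ)]
    ring
  have hf : IntervalIntegrable
      (fun θ : ℝ => (θ : ℂ) * (1 / (Complex.log (1 + circleMap 0 1 θ) - a))) volume (-π) π := by
    simp_rw [hsum]
    exact hgi.add (hpi'.const_mul _)
  have hval : ∫ θ in -π..π, (θ : ℂ) * (1 / (Complex.log (1 + circleMap 0 1 θ) - a))
      = ((2 * π * (-(J - Real.exp a / b * (a - Real.log b)) - Real.exp a * (a / b)) : ℝ) : ℂ)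
        * Complex.I := by
    simp_rw [hsum]
    rw [intervalIntegral.integral_add hgi (hpi'.const_mul _), intervalIntegral.integral_const_mul,
      hgint, hd, hpole]
    have : Real.log (1 + b) = a := by rw [hb, add_sub_cancel, Real.log_exp]
    rw [this]
    push_cast
    ring
  have him : ∫ θ in -π..π, -2 * integrand a (θ / 2)
      = (∫ θ in -π..π, (θ : ℂ) * (1 / (Complex.log (1 + circleMap 0 1 θ) - a))).im := by
    have h := Complex.imCLM.intervalIntegral_comp_comm hf
    rw [Complex.imCLM_apply] at h
    rw [← h]
    refine intervalIntegral.integral_congr_ae ?_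
    filter_upwards [ae_mem_Ioo_of_mem_uIoc hpi] with θ hθ h
    rw [Complex.imCLM_apply, im_mul_inv_log_sub a (hθ h)]
  rw [hval, integral_integrand_half, Complex.im_ofReal_mul, Complex.I_im] at him
  have h1 := one_sub_exp_neg_pos ha0
  have hbe : b = Real.exp a * (1 - Real.exp (-a)) := by
    rw [mul_sub, ← Real.exp_add]
    simp [hb]
  have hlogb : Real.log b = a + Real.log (1 - Real.exp (-a)) := by
    rw [hbe, Real.log_mul (Real.exp_pos a).ne' h1.ne', Real.log_exp]
  have hcb : Real.exp a / b = 1 / (1 - Real.exp (-a)) := by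
    rw [hbe]; field_simp
  have hM : M a = J + Real.exp a / b * Real.log b := by
    rw [M]
    have : ∫ x in (0 : ℝ)..(π / 2), integrand a x
      = -(2 * π * (-(J - Real.exp a / b * (a - Real.log b)) - Real.exp a * (a / b)) * 1) / 8 := by
      linarith
    rw [this]
    field_simp
    ring
  rw [hM, hcb, hlogb]
  ring

end GlasserMannaOloa

theorem mainTheorem2 (a : ℝ) (ha0 : 0 < a) (ha : a < Real.log 2) :
    IntervalIntegrable (GlasserMannaOloa.integrand a) volume 0 (Real.pi / 2) ∧
    IntegrableOn (fun t : ℝ => t ^ ((0 : ℝ) - 1) * Real.exp (-t)) (Set.Ioi a) volume ∧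
    IntervalIntegrable
      (fun t : ℝ => Real.exp (-(a * t)) * GlasserMannaOloa.digamma (t + 1)) volume 0 1 ∧
    GlasserMannaOloa.M a =
      Real.eulerMascheroniConstant / a
        + (a + Real.log (1 - Real.exp (-a)) + GlasserMannaOloa.upperGamma 0 a)
            / (1 - Real.exp (-a))
        + 1 / (1 - Real.exp (-a))
            * ∫ t in (0 : ℝ)..1, Real.exp (-(a * t)) * GlasserMannaOloa.digamma (t + 1) := by
  refine ⟨GlasserMannaOloa.intervalIntegrable_integrand a,
    GlasserMannaOloa.integrableOn_upperGamma_zero ha0,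
    GlasserMannaOloa.intervalIntegrable_exp_mul_digamma a, ?_⟩
  rw [GlasserMannaOloa.M_eq ha0 ha, GlasserMannaOloa.integral_cutKernel ha0]
  ring
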